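/- Call four points $P_i=(x_i,y_i)\in\mathbb{Q}^2$, $i=1,\dots,4$, a symmetric progression with common ratio $r\in\mathbb{Q}$ on the circle $(x-h)^2+y^2=a^2$ ($h,a\in\mathbb{Q}$, $a>0$) if all four lie on the circle, $r>1$, the abscissae are positive and satisfy $x_{i+1}=rx_i$ for $i=1,2,3$, the points $P_1$ and $P_4$ are mirror images of each other in the vertical diameter (that is, $x_4=2h-x_1$ and $y_4=y_1$), and none of the four points lies on the $x$-axis. (i) There are infinitely many circles with rational radius carrying a symmetric progression. More precisely, there is an infinite sequence of circles $(x-h_n)^2+y^2=a_n^2$, each carrying a symmetric progression with some common ratio $r_n>1$, such that the ratios $h_n/a_n$ are pairwise distinct (so that no two of the circles differ by a scaling $(x,y)\mapsto(\lambda x,\lambda y)$ with $\lambda>0$) and the common ratios $r_n$ are pairwise distinct. (ii) The elliptic curve $y^2=x^3-1227x+16346$ has infinitely many rational points in every neighbourhood of its point $(385,7524)$, and every rational point of the curve sufficiently close to $(385,7524)$ yields such progressions. Namely, there is $\varepsilon>0$ such that, for every rational point $(x,y)$ of the curve with $|x-385|<\varepsilon$ and $|y-7524|<\varepsilon$ and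 every rational $a>0$, if one puts $$X=-\frac{x-2y-7}{2(4x-73)},\qquad r=\frac{X^2-4}{2X+1},\qquad h=\frac{3a(r^3+1)}{5(r^3-1)},$$ then the circle $(x-h)^2+y^2=a^2$ carries a symmetric progression with common ratio $r$. -/

import Mathlib

/-- `P 0, P 1, P 2, P 3` are four rational points on the circle `(x - h)² + y² = a²` of positive
rational radius `a`, none of them on the `x`-axis, whose abscissae are positive and form a geometric
progression with common ratio `r > 1`, and whose first and last members are mirror images of each
other in the vertical diameter `x = h`. -/
structure IsSymmetricProgression (h a r : ℚ) (P : Fin 4 → ℚ × ℚ) : Prop where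
  radius_pos : 0 < a
  one_lt_ratio : 1 < r
  on_circle : ∀ i, ((P i).1 - h) ^ 2 + (P i).2 ^ 2 = a ^ 2
  abscissa_pos : ∀ i, 0 < (P i).1
  geometric : ∀ i : Fin 3, (P i.succ).1 = r * (P i.castSucc).1
  symmetric : P 3 = (2 * h - (P 0).1, (P 0).2)
  off_axis : ∀ i, (P i).2 ≠ 0

/-- The affine rational points of the elliptic curve `y² = x³ - 1227 x + 16346`. -/
def curvePoints : Set (ℚ × ℚ) :=
  {p | p.2 ^ 2 = p.1 ^ 3 - 1227 * p.1 + 16346}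

/-- The rational points of the curve in the open square of half-side `ε` around `(385, 7524)`. -/
def curvePointsNear (ε : ℚ) : Set (ℚ × ℚ) :=
  {p | p ∈ curvePoints ∧ |p.1 - 385| < ε ∧ |p.2 - 7524| < ε}

/-- The parameter `X` of a point `(x, y)`. -/
def paramX (p : ℚ × ℚ) : ℚ :=
  -(p.1 - 2 * p.2 - 7) / (2 * (4 * p.1 - 73))

/-- The common ratio `r` attached to a point `(x, y)`. -/
def ratio (p : ℚ × ℚ) : ℚ :=
  (paramX p ^ 2 - 4) / (2 * paramX p + 1)

/-- The abscissa of the centre of the circle of radius `a` attached to the common ratio `r`. -/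
def centre (a r : ℚ) : ℚ :=
  3 * a * (r ^ 3 + 1) / (5 * (r ^ 3 - 1))

/-! A common ratio `r > 1` works as soon as `r ^ 2 + r + 4` and `4 * r ^ 2 + r + 1` are both
squares. The parameter `X` rationalises the first condition; the second then asks that a quartic in
`X` be a square, which every curve point near `(385, 7524)` achieves.

It remains to find infinitely many points near `Q = (385, 7524)`. Doubling, followed 2-adically,
gives infinitely many points; compactness gives points arbitrarily close to infinity; adding these
to `Q` gives points arbitrarily close to `Q`. Since `ratio` has finite fibres, infinitely many
ratios occur. -/

/-! ### From curve points to progressions. -/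

/-- Centre, first point and its foot on the axis form a 3-4-5 triangle scaled by `k * (r ^ 3 - 1)`.
The squared ordinates of the two middle points are then rational squares times the two quadratics in
`r`. -/
theorem isSymmetricProgression_of_sq {r k S V : ℚ} (hk : 0 < k) (hr : 1 < r)
    (hS : S ^ 2 = r ^ 2 + r + 4) (hV : V ^ 2 = 4 * r ^ 2 + r + 1) :
    IsSymmetricProgression (3 * k * (r ^ 3 + 1)) (5 * k * (r ^ 3 - 1)) r
      ![(6 * k, 4 * k * (r ^ 3 - 1)), (6 * k * r, 2 * k * (r - 1) * (2 * r + 1) * S),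
        (6 * k * r ^ 2, 2 * k * (r - 1) * (r + 2) * V), (6 * k * r ^ 3, 4 * k * (r ^ 3 - 1))] := by
  have h0 : 0 < r := by linarith
  have h1 : 0 < r - 1 := by linarith
  have h3 : 0 < r ^ 3 - 1 := by
    have : r ^ 3 - 1 = (r - 1) * (r ^ 2 + r + 1) := by ring
    rw [this]; positivity
  have hS0 : S ≠ 0 := by rintro rfl; nlinarith
  have hV0 : V ≠ 0 := by rintro rfl; nlinarith
  refine ⟨by positivity, hr, ?_, ?_, ?_, ?_, ?_⟩
  · intro i
    fin_cases i <;> simp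
    · ring
    · linear_combination 4 * k ^ 2 * (r - 1) ^ 2 * (2 * r + 1) ^ 2 * hS
    · linear_combination 4 * k ^ 2 * (r - 1) ^ 2 * (r + 2) ^ 2 * hV
    · ring
  · intro i
    fin_cases i <;> simp <;> positivity
  · intro i
    fin_cases i <;> simp <;> ring
  · simp
    ring
  · intro i
    fin_cases i <;> simp only [Fin.zero_eta, Fin.mk_one, Fin.reduceFinMk, Matrix.cons_val] <;>
      positivity

/-- At `(385, 7524)` the parameter is 5 and the ratio 21/11, so there is room to keep the ratio
above 1. -/
theorem four_lt_paramX {p : ℚ × ℚ} (hp : p ∈ curvePointsNear 1) : 4 < paramX p := by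
  obtain ⟨-, h1, h2⟩ := hp
  rw [abs_lt] at h1 h2
  rw [paramX, lt_div_iff₀ (by linarith)]
  linarith

theorem paramX_mul {p : ℚ × ℚ} (hp : p ∈ curvePointsNear 1) :
    2 * p.2 = p.1 - 7 + 2 * paramX p * (4 * p.1 - 73) := by
  obtain ⟨-, h1, h2⟩ := hp
  rw [abs_lt] at h1 h2
  have : 4 * p.1 - 73 ≠ 0 := by linarith
  rw [paramX]
  generalize 4 * p.1 - 73 = u at *
  field_simp
  ring

/-- Fixing `X` fixes a line through the rational point `(73/4, 45/8)`; removing that known root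
leaves a quadratic for the other two intersections with the cubic. -/
theorem quadratic_paramX {p : ℚ × ℚ} (hp : p ∈ curvePointsNear 1) :
    (4 * p.1 - 73) ^ 2 + (218 - 16 * paramX p - 64 * paramX p ^ 2) * (4 * p.1 - 73)
      - 3735 - 720 * paramX p = 0 := by
  have hXy := paramX_mul hp
  obtain ⟨hc, h1, -⟩ := hp
  rw [abs_lt] at h1
  have hc : p.2 ^ 2 = p.1 ^ 3 - 1227 * p.1 + 16346 := hc
  have hu : 4 * p.1 - 73 ≠ 0 := by linarith
  apply mul_left_cancel₀ hu
  linear_combination (-64) * hc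
    + 16 * (2 * p.2 + (p.1 - 7 + 2 * paramX p * (4 * p.1 - 73))) * hXy

theorem ratio_mul {p : ℚ × ℚ} (hp : p ∈ curvePointsNear 1) :
    ratio p * (2 * paramX p + 1) = paramX p ^ 2 - 4 := by
  have := four_lt_paramX hp
  rw [ratio, div_mul_cancel₀ _ (by linarith)]

theorem one_lt_ratio {p : ℚ × ℚ} (hp : p ∈ curvePointsNear 1) : 1 < ratio p := by
  have := four_lt_paramX hp
  rw [ratio, lt_div_iff₀ (by linarith)]
  nlinarith

theorem exists_isSymmetricProgression {p : ℚ × ℚ} (hp : p ∈ curvePointsNear 1) {a : ℚ}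
    (ha : 0 < a) : ∃ P, IsSymmetricProgression (centre a (ratio p)) a (ratio p) P := by
  have hX := four_lt_paramX hp
  have hq := quadratic_paramX hp
  have hrX := ratio_mul hp
  have hr := one_lt_ratio hp
  rw [centre]
  generalize ratio p = r at *
  generalize paramX p = X at *
  have hd : 2 * X + 1 ≠ 0 := by linarith
  have h3 : 0 < r ^ 3 - 1 := by
    have : r ^ 3 - 1 = (r - 1) * (r ^ 2 + r + 1) := by ring
    have : 0 < r - 1 := by linarith
    have : 0 < r := by linarith
    rw [‹r ^ 3 - 1 = _›]; positivity
  -- The lines `S = X - r` parametrise the conic `S ^ 2 = r ^ 2 + r + 4`.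
  have hS : (X - r) ^ 2 = r ^ 2 + r + 4 := by linear_combination - hrX
  -- The quadratic in `4 * p.1 - 73` has a rational root, so its discriminant is a square; up to a
  -- square factor it is the required quartic.
  have hV : ((2 * (4 * p.1 - 73) + 218 - 16 * X - 64 * X ^ 2) / (32 * (2 * X + 1))) ^ 2
      = 4 * r ^ 2 + r + 1 := by
    have hr' : r = (X ^ 2 - 4) / (2 * X + 1) := by rw [eq_div_iff hd, hrX]
    rw [hr']
    field_simp
    linear_combination 4 * hq
  have key := isSymmetricProgression_of_sq (k := a / (5 * (r ^ 3 - 1))) (by positivity) hr hS hV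
  have e₁ : 3 * (a / (5 * (r ^ 3 - 1))) * (r ^ 3 + 1)
      = 3 * a * (r ^ 3 + 1) / (5 * (r ^ 3 - 1)) := by ring
  have e₂ : 5 * (a / (5 * (r ^ 3 - 1))) * (r ^ 3 - 1) = a := by
    have := h3.ne'
    field_simp
  rw [e₁, e₂] at key
  exact ⟨_, key⟩

/-! ### Chord and tangent operations. -/

theorem chord_mem_curvePoints {p q : ℚ × ℚ} (hp : p ∈ curvePoints) (hq : q ∈ curvePoints)
    (h : p.1 ≠ q.1) {l x : ℚ} (hl : l = (p.2 - q.2) / (p.1 - q.1)) (hx : x = l ^ 2 - p.1 - q.1) :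
    (x, -(l * (x - p.1) + p.2)) ∈ curvePoints := by
  obtain ⟨x₁, y₁⟩ := p
  obtain ⟨x₂, y₂⟩ := q
  simp only [curvePoints, Set.mem_ofPred_eq] at *
  have hd : x₁ - x₂ ≠ 0 := sub_ne_zero.2 h
  have e : l * (x₁ - x₂) = y₁ - y₂ := by rw [hl, div_mul_cancel₀ _ hd]
  have hy : y₂ = y₁ - l * (x₁ - x₂) := by linear_combination e
  have h3 : 2 * l * y₁ - l ^ 2 * (x₁ - x₂) = x₁ ^ 2 + x₁ * x₂ + x₂ ^ 2 - 1227 := by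
    apply mul_left_cancel₀ hd
    rw [hy] at hq
    linear_combination hp - hq
  subst hx
  linear_combination hp + (l ^ 2 - x₁ - x₂ - x₁) * h3

theorem neg_mem_curvePoints {p : ℚ × ℚ} (hp : p ∈ curvePoints) : (p.1, -p.2) ∈ curvePoints := by
  simpa [curvePoints] using hp

theorem tangent_mem_curvePoints {p : ℚ × ℚ} (hp : p ∈ curvePoints) (h : p.2 ≠ 0) {l x : ℚ}
    (hl : l = (3 * p.1 ^ 2 - 1227) / (2 * p.2)) (hx : x = l ^ 2 - 2 * p.1) :
    (x, -(l * (x - p.1) + p.2)) ∈ curvePoints := by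
  obtain ⟨x₁, y₁⟩ := p
  simp only [curvePoints, Set.mem_ofPred_eq] at *
  have e : l * (2 * y₁) = 3 * x₁ ^ 2 - 1227 := by rw [hl, div_mul_cancel₀ _ (by simpa using h)]
  subst hx
  linear_combination hp + (l ^ 2 - 3 * x₁) * e

/-! ### Infinitely many points, by 2-adic growth under doubling. -/

theorem padicNorm_pow {p : ℕ} [Fact p.Prime] (a : ℚ) (n : ℕ) :
    padicNorm p (a ^ n) = padicNorm p a ^ n := by
  induction n with
  | zero => simp
  | succ n ih => rw [pow_succ, padicNorm.mul, ih, pow_succ]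

theorem padicNorm_add_eq_left {p : ℕ} [Fact p.Prime] {a b : ℚ}
    (h : padicNorm p b < padicNorm p a) : padicNorm p (a + b) = padicNorm p a := by
  rw [padicNorm.add_eq_max_of_ne h.ne', max_eq_left h.le]

theorem padicNorm_cubic {x : ℚ} (hx : 1 < padicNorm 2 x) :
    padicNorm 2 (x ^ 3 - 1227 * x + 16346) = padicNorm 2 x ^ 3 := by
  have h1 := padicNorm.of_int (p := 2) (-1227)
  have h2 := padicNorm.of_int (p := 2) 16346
  push_cast at h1 h2
  have h0 := padicNorm.nonneg (p := 2) (-1227)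
  have h3 : 1 < padicNorm 2 x ^ 3 := one_lt_pow₀ hx (by norm_num)
  have h4 : padicNorm 2 x < padicNorm 2 x ^ 3 := lt_self_pow₀ hx (by norm_num)
  have : padicNorm 2 (-1227 * x + 16346) < padicNorm 2 (x ^ 3) := by
    refine (padicNorm.nonarchimedean).trans_lt (max_lt ?_ ?_)
    · rw [padicNorm.mul, padicNorm_pow]
      nlinarith
    · rw [padicNorm_pow]; linarith
  rw [show x ^ 3 - 1227 * x + 16346 = x ^ 3 + (-1227 * x + 16346) by ring,
    padicNorm_add_eq_left this, padicNorm_pow]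

theorem padicNorm_quartic {x : ℚ} (hx : 1 < padicNorm 2 x) :
    padicNorm 2 (x ^ 4 + 2454 * x ^ 2 - 130768 * x + 1505529) = padicNorm 2 x ^ 4 := by
  have h1 := padicNorm.of_int (p := 2) 2454
  have h2 := padicNorm.of_int (p := 2) (-130768)
  have h3 := padicNorm.of_int (p := 2) 1505529
  push_cast at h1 h2 h3
  have hx2 : 1 < padicNorm 2 x ^ 2 := one_lt_pow₀ hx (by norm_num)
  have hx4 : 1 < padicNorm 2 x ^ 4 := one_lt_pow₀ hx (by norm_num)
  have h4 : padicNorm 2 x < padicNorm 2 x ^ 4 := lt_self_pow₀ hx (by norm_num)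
  have h5 : padicNorm 2 x ^ 2 < padicNorm 2 x ^ 4 := pow_lt_pow_right₀ hx (by norm_num)
  have : padicNorm 2 (2454 * x ^ 2 + (-130768 * x + 1505529)) < padicNorm 2 (x ^ 4) := by
    refine (padicNorm.nonarchimedean).trans_lt
      (max_lt ?_ ((padicNorm.nonarchimedean).trans_lt (max_lt ?_ ?_)))
    · rw [padicNorm.mul, padicNorm_pow, padicNorm_pow]
      nlinarith
    · rw [padicNorm.mul, padicNorm_pow]
      nlinarith
    · rw [padicNorm_pow]; linarith
  rw [show x ^ 4 + 2454 * x ^ 2 - 130768 * x + 1505529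
      = x ^ 4 + (2454 * x ^ 2 + (-130768 * x + 1505529)) by ring,
    padicNorm_add_eq_left this, padicNorm_pow]

theorem padicNorm_two_four : padicNorm 2 4 = 1 / 4 := by
  rw [show (4 : ℚ) = 2 ^ 2 by norm_num, padicNorm_pow]
  have := padicNorm.padicNorm_p_of_prime (p := 2)
  push_cast at this
  rw [this]; norm_num

/-- In the duplication formula the leading terms dominate 2-adically, so a norm `N > 1` becomes `N ^
4 / (N ^ 3 / 4) = 4 * N`. -/
theorem exists_mem_curvePoints_padicNorm (n : ℕ) :
    ∃ p ∈ curvePoints, padicNorm 2 p.1 = 4 ^ (n + 1) := by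
  induction n with
  | zero =>
    refine ⟨(73 / 4, 45 / 8), by norm_num [curvePoints], ?_⟩
    have : padicNorm 2 73 = 1 := by
      have := (padicNorm.int_eq_one_iff (p := 2) 73).2 (by norm_num)
      exact_mod_cast this
    rw [padicNorm.div, padicNorm_two_four, this]
    norm_num
  | succ n ih =>
    obtain ⟨p, hp, hn⟩ := ih
    have hx : 1 < padicNorm 2 p.1 := by
      rw [hn]; exact one_lt_pow₀ (by norm_num) (by norm_num)
    have hc : p.2 ^ 2 = p.1 ^ 3 - 1227 * p.1 + 16346 := hp
    have hf := padicNorm_cubic hx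
    have hy : p.2 ≠ 0 := by
      intro h0
      rw [← hc, h0] at hf
      have : 0 < padicNorm 2 p.1 ^ 3 := by positivity
      simp at hf
      simp [← hf] at this
    refine ⟨_, tangent_mem_curvePoints hp hy rfl rfl, ?_⟩
    have : ((3 * p.1 ^ 2 - 1227) / (2 * p.2)) ^ 2 - 2 * p.1 =
        (p.1 ^ 4 + 2454 * p.1 ^ 2 - 130768 * p.1 + 1505529) /
          (4 * (p.1 ^ 3 - 1227 * p.1 + 16346)) := by
      rw [← hc]
      field_simp
      linear_combination (-32 * p.1) * hc
    dsimp only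
    rw [this, padicNorm.div, padicNorm.mul, padicNorm_quartic hx, hf, padicNorm_two_four, hn]
    field_simp
    ring

/-! ### Points near infinity and near `(385, 7524)`. -/

/-- If abscissae were bounded, infinitely many points would accumulate, and differences of nearby
points would have bounded abscissa. This forces the accumulation point to be singular, but the curve
is smooth. -/
theorem exists_mem_curvePoints_lt (M : ℚ) : ∃ p ∈ curvePoints, M < p.1 := by
  by_contra! hM
  wlog hM1 : 1 ≤ M generalizing M
  · exact this (max M 1) (fun p hp => (hM p hp).trans (le_max_left _ _)) (le_max_right _ _)
  choose p hp hn using exists_mem_curvePoints_padicNorm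
  have hinj : Function.Injective fun n => (p n).1 := by
    intro m n h
    have h : (p m).1 = (p n).1 := h
    have h' := hn m
    rw [h, hn n] at h'
    have := pow_right_injective₀ (a := (4 : ℚ)) (by norm_num) (by norm_num) h'
    omega
  have lower (n) : -41 ≤ (p n).1 := by
    have hc : (p n).2 ^ 2 = (p n).1 ^ 3 - 1227 * (p n).1 + 16346 := hp n
    nlinarith [sq_nonneg (p n).2, sq_nonneg ((p n).1 + 41), sq_nonneg ((p n).1 - 22)]
  have ordinate (n) : |(p n).2| ≤ M ^ 3 + 66654 := by
    have hc : (p n).2 ^ 2 = (p n).1 ^ 3 - 1227 * (p n).1 + 16346 := hp n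
    have h3 : (p n).1 ^ 3 ≤ M ^ 3 := (Odd.pow_le_pow (by decide)).2 (hM _ (hp n))
    have hM3 : 0 ≤ M ^ 3 := by positivity
    apply abs_le_of_sq_le_sq _ (by positivity)
    nlinarith [lower n]
  -- The difference of the two points has abscissa at most `M`, which bounds the squared slope of
  -- the chord by `3 * M`.
  have chord (m n) (h : (p m).1 ≠ (p n).1) :
      ((p m).2 + (p n).2) ^ 2 ≤ 3 * M * ((p m).1 - (p n).1) ^ 2 := by
    have := hM _ (chord_mem_curvePoints (hp m) (neg_mem_curvePoints (hp n)) h rfl rfl)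
    dsimp only at this
    have hd : 0 < ((p m).1 - (p n).1) ^ 2 := by have := sub_ne_zero.2 h; positivity
    rw [← div_le_iff₀ hd, ← div_pow]
    have h1 := hM _ (hp m)
    have h2 := hM _ (hp n)
    rw [sub_neg_eq_add] at this
    linarith
  have chord' (m n) (h : (p m).1 ≠ (p n).1) :
      ((p m).1 ^ 2 + (p m).1 * (p n).1 + (p n).1 ^ 2 - 1227) ^ 2
        ≤ 3 * M * ((p m).2 - (p n).2) ^ 2 := by
    have hd : 0 < ((p m).1 - (p n).1) ^ 2 := by have := sub_ne_zero.2 h; positivity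
    have e : (p m).2 ^ 2 = (p m).1 ^ 3 - 1227 * (p m).1 + 16346 := hp m
    have e' : (p n).2 ^ 2 = (p n).1 ^ 3 - 1227 * (p n).1 + 16346 := hp n
    have e'' : ((p m).1 - (p n).1) * ((p m).1 ^ 2 + (p m).1 * (p n).1 + (p n).1 ^ 2 - 1227)
        = ((p m).2 - (p n).2) * ((p m).2 + (p n).2) := by linear_combination e' - e
    refine le_of_mul_le_mul_left ?_ hd
    rw [← mul_pow, e'', mul_pow]
    nlinarith [mul_le_mul_of_nonneg_left (chord m n h) (sq_nonneg ((p m).2 - (p n).2))]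
  have hK : IsCompact (Set.Icc (-41 : ℝ) M ×ˢ Set.Icc (-(M ^ 3 + 66654 : ℝ)) (M ^ 3 + 66654)) :=
    isCompact_Icc.prod isCompact_Icc
  obtain ⟨⟨x, y⟩, -, φ, hφ, hlim⟩ := hK.tendsto_subseq
    (x := fun n => (((p n).1 : ℝ), ((p n).2 : ℝ))) (fun n => by
      have h1 := abs_le.1 (ordinate n)
      refine ⟨⟨?_, ?_⟩, ?_, ?_⟩
      · dsimp only; exact_mod_cast lower n
      · dsimp only; exact_mod_cast hM _ (hp n)
      · dsimp only; exact_mod_cast h1.1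
      · dsimp only; exact_mod_cast h1.2)
  have hx : Filter.Tendsto (fun n => ((p (φ n)).1 : ℝ)) Filter.atTop (nhds x) :=
    (continuous_fst.tendsto _).comp hlim
  have hy : Filter.Tendsto (fun n => ((p (φ n)).2 : ℝ)) Filter.atTop (nhds y) :=
    (continuous_snd.tendsto _).comp hlim
  have hx' := hx.comp (Filter.tendsto_add_atTop_nat 1)
  have hy' := hy.comp (Filter.tendsto_add_atTop_nat 1)
  have hne (n) : (p (φ (n + 1))).1 ≠ (p (φ n)).1 := fun h =>
    (hφ (Nat.lt_succ_self n)).ne' (hinj h)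
  -- Consecutive terms of the subsequence share the limit, so both right-hand sides tend to 0 and
  -- both partial derivatives of the curve equation vanish there.
  have l1 : (y + y) ^ 2 ≤ 3 * M * (x - x) ^ 2 :=
    le_of_tendsto_of_tendsto' ((hy'.add hy).pow 2) (((hx'.sub hx).pow 2).const_mul _)
      (fun n => by simpa using (by exact_mod_cast chord _ _ (hne n)))
  have l2 : (x ^ 2 + x * x + x ^ 2 - 1227) ^ 2 ≤ 3 * M * (y - y) ^ 2 :=
    le_of_tendsto_of_tendsto'
      (((((hx'.pow 2).add (hx'.mul hx)).add (hx.pow 2)).sub_const 1227).pow 2)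
      (((hy'.sub hy).pow 2).const_mul _)
      (fun n => by simpa using (by exact_mod_cast chord' _ _ (hne n)))
  have l3 : y ^ 2 = x ^ 3 - 1227 * x + 16346 :=
    tendsto_nhds_unique (hy.pow 2)
      ((((hx.pow 3).sub (hx.const_mul 1227)).add_const 16346).congr fun n => by
        have e : (p (φ n)).2 ^ 2 = (p (φ n)).1 ^ 3 - 1227 * (p (φ n)).1 + 16346 := hp (φ n)
        exact_mod_cast e.symm)
  have hy0 : y = 0 := by nlinarith
  have hx0 : x ^ 2 = 409 := by nlinarith
  subst hy0
  have : x = 16346 / 818 := by linear_combination (1 / 818) * l3 + (x / 818) * hx0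
  rw [this] at hx0
  norm_num at hx0

theorem exists_curvePointsNear_ne {ε : ℚ} (hε : 0 < ε) :
    ∃ p ∈ curvePointsNear ε, p ≠ (385, 7524) := by
  -- In the coordinates `(1 / x, y / x ^ 2)`, which vanish at infinity, `F` is the abscissa of
  -- `(385, 7524) + (x, y)` minus 385, and `G` is the chord slope times `F`. The curve equation has
  -- cancelled the terms singular at the origin.
  let F : ℚ × ℚ → ℚ := fun z => (443448 * z.1 - 57506328 * z.1 ^ 2 - 15048 * z.2)
    / (1 - 385 * z.1) ^ 2
  let G : ℚ × ℚ → ℚ := fun z => (z.2 * (443448 - 57506328 * z.1)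
    - 15048 * (1 - 1227 * z.1 ^ 2 + 16346 * z.1 ^ 3)
    - 7524 * z.1 * (443448 * z.1 - 57506328 * z.1 ^ 2 - 15048 * z.2)) / (1 - 385 * z.1) ^ 3
  have hF : ContinuousAt F (0, 0) := by
    refine ContinuousAt.div (by fun_prop) (by fun_prop) (by simp)
  have hG : ContinuousAt G (0, 0) := by
    refine ContinuousAt.div (by fun_prop) (by fun_prop) (by simp)
  have hF0 : F (0, 0) = 0 := by simp [F]
  have hG0 : G (0, 0) = -15048 := by simp [G]
  have hF' := hF.eventually (eventually_abs_sub_lt (F (0, 0)) hε)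
  have hG' := hG.eventually (eventually_abs_sub_lt (G (0, 0)) hε)
  rw [hF0] at hF'
  rw [hG0] at hG'
  obtain ⟨⟨δ₁, δ₂⟩, ⟨hδ₁, hδ₂⟩, hδ⟩ :=
    ((nhds_basis_abs_sub_lt (0 : ℚ)).prod_nhds (nhds_basis_abs_sub_lt (0 : ℚ))).eventually_iff.1
      (hF'.and hG')
  dsimp only at hδ₁ hδ₂
  obtain ⟨⟨x, y⟩, hp, hM⟩ := exists_mem_curvePoints_lt (max 400 (max (1 / δ₁) (1 / δ₂ ^ 2)))
  simp only [max_lt_iff] at hM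
  obtain ⟨hx, hx₁, hx₂⟩ := hM
  have hc : y ^ 2 = x ^ 3 - 1227 * x + 16346 := hp
  have hx0 : 0 < x := by linarith
  have hd : x - 385 ≠ 0 := by linarith
  have hs : (y / x ^ 2) ^ 2 < δ₂ ^ 2 := by
    rw [div_lt_iff₀ (by positivity)] at hx₂
    rw [div_pow, div_lt_iff₀ (by positivity), hc]
    have := mul_lt_mul_of_pos_right hx₂ (pow_pos hx0 3)
    linarith
  obtain ⟨h1, h2⟩ := hδ (show (1 / x, y / x ^ 2) ∈ _ from ⟨by
    show |1 / x - 0| < δ₁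
    rw [sub_zero, abs_of_pos (by positivity)]
    exact (one_div_lt hδ₁ hx0).1 hx₁, by
    show |y / x ^ 2 - 0| < δ₂
    rw [sub_zero]
    exact abs_lt_of_sq_lt_sq hs hδ₂.le⟩)
  have hQ : ((385, 7524) : ℚ × ℚ) ∈ curvePoints := by norm_num [curvePoints]
  have hF₁ : ((y - 7524) / (x - 385)) ^ 2 - 385 - x - 385 = F (1 / x, y / x ^ 2) := by
    simp only [F]
    have : 1 - 385 * (1 / x) = (x - 385) / x := by field_simp
    rw [this]
    field_simp
    linear_combination hc
  have hG₁ : (y - 7524) / (x - 385) * F (1 / x, y / x ^ 2) = G (1 / x, y / x ^ 2) := by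
    simp only [F, G]
    have : 1 - 385 * (1 / x) = (x - 385) / x := by field_simp
    rw [this]
    field_simp
    linear_combination (-15048) * hc
  have hl : (y - 7524) / (x - 385) = (7524 - y) / (385 - x) := by
    rw [← neg_sub, ← neg_sub 385 x, neg_div_neg_eq]
  refine ⟨_, ⟨chord_mem_curvePoints hQ hp (by dsimp only; linarith)
    (l := (y - 7524) / (x - 385)) hl rfl, ?_, ?_⟩, ?_⟩
  · dsimp only
    rwa [hF₁, ← sub_zero (F _)]
  · dsimp only
    rw [hF₁, hG₁, ← abs_neg]
    rwa [show ∀ g : ℚ, -(-(g + 7524) - 7524) = g - -15048 from fun g => by ring]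
  · intro h
    rw [Prod.mk.injEq] at h
    obtain ⟨h, h'⟩ := h
    rw [h] at h'
    norm_num at h'

theorem infinite_curvePointsNear {ε : ℚ} (hε : 0 < ε) : (curvePointsNear ε).Infinite := by
  intro hfin
  let f : ℚ × ℚ → ℚ := fun p => max |p.1 - 385| |p.2 - 7524|
  obtain ⟨p, ⟨hp, hne⟩, hmin⟩ := Set.exists_min_image (curvePointsNear ε \ {(385, 7524)}) f
    hfin.sdiff (exists_curvePointsNear_ne hε)
  have hpos : 0 < f p := by
    rw [lt_max_iff]
    by_contra! h
    apply hne
    have h1 := abs_nonpos_iff.1 h.1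
    have h2 := abs_nonpos_iff.1 h.2
    exact Prod.ext (by linarith) (by linarith)
  obtain ⟨q, ⟨hq, hq₁, hq₂⟩, hq'⟩ := exists_curvePointsNear_ne hpos
  have hpε : f p < ε := max_lt hp.2.1 hp.2.2
  exact (hmin q ⟨⟨hq, hq₁.trans hpε, hq₂.trans hpε⟩, hq'⟩).not_gt (max_lt hq₁ hq₂)

/-! ### Infinitely many ratios. -/

theorem finite_quadratic (b c : ℚ) : {x : ℚ | x ^ 2 + b * x + c = 0}.Finite := by
  rcases Set.eq_empty_or_nonempty {x : ℚ | x ^ 2 + b * x + c = 0} with h | ⟨x, hx : _ = _⟩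
  · rw [h]; exact Set.finite_empty
  · refine (Set.toFinite {x, -b - x}).subset fun z (hz : _ = _) => ?_
    have : (z - x) * (z - (-b - x)) = 0 := by linear_combination hz - hx
    rcases mul_eq_zero.1 this with h | h
    · exact Or.inl (sub_eq_zero.1 h)
    · exact Or.inr (sub_eq_zero.1 h)

/-- A ratio allows at most two `X`, each `X` at most two abscissae, and `X` with the abscissa
determines the ordinate. -/
theorem infinite_ratio_image : (ratio '' curvePointsNear 1).Infinite := by
  intro h
  refine infinite_curvePointsNear one_pos (Set.Finite.of_finite_fibers ratio h fun r _ => ?_)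
  refine Set.Finite.of_finite_fibers paramX
    ((finite_quadratic (-2 * r) (-4 - r)).subset ?_) fun X _ => ?_
  · rintro _ ⟨p, ⟨hp, rfl⟩, rfl⟩
    have := ratio_mul hp
    show _ = _
    linear_combination -this
  · refine Set.Finite.of_finite_fibers (fun p => 4 * p.1 - 73)
      ((finite_quadratic (218 - 16 * X - 64 * X ^ 2) (-3735 - 720 * X)).subset ?_)
      fun u _ => Set.Subsingleton.finite ?_
    · rintro _ ⟨p, ⟨⟨hp, -⟩, rfl⟩, rfl⟩
      have := quadratic_paramX hp
      show _ = _
      linear_combination this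
    · rintro p ⟨⟨⟨hp, -⟩, hpX : _ = _⟩, hpu : _ = _⟩ q ⟨⟨⟨hq, -⟩, hqX : _ = _⟩, hqu : _ = _⟩
      have hp' := paramX_mul hp
      have hq' := paramX_mul hq
      have h1 : p.1 = q.1 := by linarith
      rw [hpX, h1] at hp'
      rw [hqX] at hq'
      exact Prod.ext h1 (by linarith)

theorem mainTheorem3 :
    (∃ (h a r : ℕ → ℚ) (P : ℕ → Fin 4 → ℚ × ℚ),
      Function.Injective (fun n => h n / a n) ∧ Function.Injective r ∧
        ∀ n, IsSymmetricProgression (h n) (a n) (r n) (P n)) ∧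
    (∀ ε : ℚ, 0 < ε → (curvePointsNear ε).Infinite) ∧
    (∃ ε : ℚ, 0 < ε ∧ ∀ p ∈ curvePointsNear ε, ∀ a : ℚ, 0 < a →
      ∃ P : Fin 4 → ℚ × ℚ, IsSymmetricProgression (centre a (ratio p)) a (ratio p) P) := by
  refine ⟨?_, fun ε hε => infinite_curvePointsNear hε, 1, one_pos,
    fun p hp a ha => exists_isSymmetricProgression hp ha⟩
  let e := infinite_ratio_image.natEmbedding
  have hP (n : ℕ) : 1 < (e n : ℚ) ∧ ∃ P, IsSymmetricProgression (centre 1 (e n)) 1 (e n) P := by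
    obtain ⟨p, hp, h⟩ := (e n).2
    rw [← h]
    exact ⟨one_lt_ratio hp, exists_isSymmetricProgression hp one_pos⟩
  choose hr P hP using hP
  have hinj : Function.Injective fun n => (e n : ℚ) := Subtype.val_injective.comp e.injective
  refine ⟨fun n => centre 1 (e n), fun _ => 1, fun n => e n, P, fun m n h => hinj ?_, hinj, hP⟩
  have h3 (n) : 1 < (e n : ℚ) ^ 3 := one_lt_pow₀ (hr n) (by norm_num)
  have hm : (e m : ℚ) ^ 3 - 1 ≠ 0 := by linarith [h3 m]
  have hn : (e n : ℚ) ^ 3 - 1 ≠ 0 := by linarith [h3 n]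
  simp only [centre] at h
  field_simp at h
  -- The centre is a Möbius function of `r ^ 3`, hence determines `r ^ 3`.
  refine (Odd.strictMono_pow (n := 3) (by decide)).injective ?_
  dsimp only
  linarith
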